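/- All actions are right actions; $x^y=y^{-1}xy$ and $[x,y]=x^{-1}y^{-1}xy$ in any group. Two groups $G,H$ acting on each other by automorphisms act compatibly if $g^{(h^{g_1})}=((g^{g_1^{-1}})^h)^{g_1}$ and $h^{(g^{h_1})}=((h^{h_1^{-1}})^g)^{h_1}$ for all $g,g_1\in G$, $h,h_1\in H$. In that case their non-abelian tensor product $G\otimes H$ is the group generated by the symbols $g\otimes h$ ($g\in G$, $h\in H$) subject to the relations $$gg_1\otimes h=(g^{g_1}\otimes h^{g_1})(g_1\otimes h),\qquad g\otimes hh_1=(g\otimes h_1)(g^{h_1}\otimes h^{h_1})$$ for all $g,g_1\in G$, $h,h_1\in H$. For a group $G$ put $G^{\otimes 1}=G$, with $G$ acting on itself by conjugation, and $\lambda_1=\mathrm{id}_G$. For $n\ge 2$ let $G^{\otimes n}=G^{\otimes (n-1)}\otimes G$, where $x\in G^{\otimes (n-1)}$ acts on $G$ by $g^x=\lambda_{n-1}(x)^{-1}\,g\,\lambda_{n-1}(x)$, the group $G$ acts on $G^{\otimes n}$ by $(x\otimes g)^h=x^h\otimes g^h$, and $\lambda_n\colon G^{\otimes n}\to G$ is the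 homomorphism with $x\otimes g\mapsto[\lambda_{n-1}(x),g]$; thus $\lambda_n(((g_1\otimes g_2)\otimes\cdots)\otimes g_n)=[g_1,g_2,\ldots,g_n]$, the left-normed commutator. These maps and actions are well defined and the actions are compatible. Let $\gamma_1(G)=G$ and $\gamma_{k+1}(G)=[\gamma_k(G),G]$. **Theorem.** Let $G$ be a finitely presented group and let $n\ge 2$. Then the $n$-fold non-abelian tensor product $G^{\otimes n}$ is finitely presented if and only if $\gamma_n(G)$ is finitely presented. -/

import Mathlib

universe u v

/-- A right action `x ^ g` of `G` on the group `X` by automorphisms is a homomorphism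
`Gᵐᵒᵖ →* MulAut X`; this is the element `x ^ g`. -/
def rpowAct {G : Type u} {X : Type v} [Group G] [Group X]
    (ρ : Gᵐᵒᵖ →* MulAut X) (x : X) (g : G) : X :=
  ρ (MulOpposite.op g) x

section rpowAct

variable {G : Type u} {X : Type v} [Group G] [Group X] (ρ : Gᵐᵒᵖ →* MulAut X)

theorem rpowAct_mul_left (x y : X) (g : G) :
    rpowAct ρ (x * y) g = rpowAct ρ x g * rpowAct ρ y g := by
  simp [rpowAct]

theorem rpowAct_inv_left (x : X) (g : G) : rpowAct ρ x⁻¹ g = (rpowAct ρ x g)⁻¹ := by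
  simp [rpowAct]

theorem rpowAct_one (x : X) : rpowAct ρ x (1 : G) = x := by
  simp [rpowAct]

theorem rpowAct_mul (x : X) (g h : G) : rpowAct ρ x (g * h) = rpowAct ρ (rpowAct ρ x g) h := by
  simp [rpowAct]

end rpowAct

/-- The conjugation action of a group on itself, `x ^ g = g⁻¹ * x * g`. -/
def conjRight (G : Type u) [Group G] : Gᵐᵒᵖ →* MulAut G where
  toFun g := MulAut.conj g.unop⁻¹
  map_one' := by simp
  map_mul' a b := by simp

theorem rpowAct_conjRight {G : Type u} [Group G] (x g : G) :
    rpowAct (conjRight G) x g = g⁻¹ * x * g := by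
  simp [rpowAct, conjRight]

/-- Two groups `G` and `H`, with `G` acting on `H` by `ρ` and `H` acting on `G` by `σ`, act
compatibly on each other (each group acts on itself by conjugation `x ^ y = y⁻¹ * x * y`):
`g ^ (h ^ g₁) = ((g ^ g₁⁻¹) ^ h) ^ g₁` and `h ^ (g ^ h₁) = ((h ^ h₁⁻¹) ^ g) ^ h₁`. -/
def CompatibleActions {G : Type u} {H : Type v} [Group G] [Group H]
    (ρ : Gᵐᵒᵖ →* MulAut H) (σ : Hᵐᵒᵖ →* MulAut G) : Prop :=
  (∀ (g g₁ : G) (h : H), rpowAct σ g (rpowAct ρ h g₁) =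
    g₁⁻¹ * rpowAct σ (g₁ * g * g₁⁻¹) h * g₁) ∧
  (∀ (h h₁ : H) (g : G), rpowAct ρ h (rpowAct σ g h₁) =
    h₁⁻¹ * rpowAct ρ (h₁ * h * h₁⁻¹) g * h₁)

/-- The defining relations of the non-abelian tensor product `G ⊗ H`:
`g g₁ ⊗ h = (g ^ g₁ ⊗ h ^ g₁) (g₁ ⊗ h)` and `g ⊗ h h₁ = (g ⊗ h₁) (g ^ h₁ ⊗ h ^ h₁)`. -/
def nonabelianTensorRels {G : Type u} {H : Type v} [Group G] [Group H]
    (ρ : Gᵐᵒᵖ →* MulAut H) (σ : Hᵐᵒᵖ →* MulAut G) : Set (FreeGroup (G × H)) :=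
  {r | ∃ (g g₁ : G) (h : H), r = FreeGroup.of (g * g₁, h) *
      (FreeGroup.of (g₁⁻¹ * g * g₁, rpowAct ρ h g₁) * FreeGroup.of (g₁, h))⁻¹} ∪
  {r | ∃ (g : G) (h h₁ : H), r = FreeGroup.of (g, h * h₁) *
      (FreeGroup.of (g, h₁) * FreeGroup.of (rpowAct σ g h₁, h₁⁻¹ * h * h₁))⁻¹}

/-- The non-abelian tensor product `G ⊗ H`, generated by the symbols `g ⊗ h`, for groups acting
on each other by `ρ` and `σ` (meant for compatible actions). -/
abbrev NonabelianTensor {G : Type u} {H : Type v} [Group G] [Group H]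
    (ρ : Gᵐᵒᵖ →* MulAut H) (σ : Hᵐᵒᵖ →* MulAut G) : Type (max u v) :=
  PresentedGroup (nonabelianTensorRels ρ σ)

namespace NonabelianTensor

variable {G : Type u} {H : Type v} [Group G] [Group H]
  (ρ : Gᵐᵒᵖ →* MulAut H) (σ : Hᵐᵒᵖ →* MulAut G)

/-- The generator `g ⊗ h`. -/
def tmul (g : G) (h : H) : NonabelianTensor ρ σ := PresentedGroup.of (g, h)

theorem mul_tmul (g g₁ : G) (h : H) : tmul ρ σ (g * g₁) h =
    tmul ρ σ (g₁⁻¹ * g * g₁) (rpowAct ρ h g₁) * tmul ρ σ g₁ h :=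
  PresentedGroup.mk_eq_mk_of_mul_inv_mem (Or.inl ⟨g, g₁, h, rfl⟩)

theorem tmul_mul (g : G) (h h₁ : H) : tmul ρ σ g (h * h₁) =
    tmul ρ σ g h₁ * tmul ρ σ (rpowAct σ g h₁) (h₁⁻¹ * h * h₁) :=
  PresentedGroup.mk_eq_mk_of_mul_inv_mem (Or.inr ⟨g, h, h₁, rfl⟩)

variable {ρ σ}

/-- The universal property of `G ⊗ H`. -/
def lift {K : Type*} [Group K] (f : G → H → K)
    (h₁ : ∀ (g g₁ : G) (h : H), f (g * g₁) h = f (g₁⁻¹ * g * g₁) (rpowAct ρ h g₁) * f g₁ h)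
    (h₂ : ∀ (g : G) (h h₁ : H), f g (h * h₁) = f g h₁ * f (rpowAct σ g h₁) (h₁⁻¹ * h * h₁)) :
    NonabelianTensor ρ σ →* K :=
  PresentedGroup.toGroup (f := fun p : G × H => f p.1 p.2) (by
    rintro r (⟨g, g₁, h, rfl⟩ | ⟨g, h, h₁', rfl⟩)
    · simp only [map_mul, map_inv, FreeGroup.lift_apply_of]
      rw [h₁, mul_inv_cancel]
    · simp only [map_mul, map_inv, FreeGroup.lift_apply_of]
      rw [h₂, mul_inv_cancel])

theorem lift_tmul {K : Type*} [Group K] (f : G → H → K) (h₁) (h₂) (g : G) (h : H) :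
    lift (ρ := ρ) (σ := σ) f h₁ h₂ (tmul ρ σ g h) = f g h :=
  PresentedGroup.toGroup.of _

theorem hom_ext {K : Type*} [Group K] {φ ψ : NonabelianTensor ρ σ →* K}
    (h : ∀ g k, φ (tmul ρ σ g k) = ψ (tmul ρ σ g k)) : φ = ψ :=
  PresentedGroup.ext fun x => h x.1 x.2

end NonabelianTensor

/-- A crossed module `bdry : M → G` over `G`, with `G` acting on `M` from the right. -/
structure CrossedMod (G : Type u) [Group G] where
  /-- The group `M`. -/
  carrier : Type u
  [group : Group carrier]
  /-- The right action of `G` on `M`. -/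
  act : Gᵐᵒᵖ →* MulAut carrier
  /-- The boundary homomorphism. -/
  bdry : carrier →* G
  bdry_act : ∀ (m : carrier) (g : G), bdry (rpowAct act m g) = g⁻¹ * bdry m * g
  peiffer : ∀ m m₁ : carrier, rpowAct act m (bdry m₁) = m₁⁻¹ * m * m₁

attribute [instance] CrossedMod.group

namespace CrossedMod

/-- The identity crossed module `G → G`. -/
def self (G : Type u) [Group G] : CrossedMod G where
  carrier := G
  act := conjRight G
  bdry := MonoidHom.id G
  bdry_act m g := by simp [rpowAct_conjRight]
  peiffer m m₁ := by simp [rpowAct_conjRight]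

variable {G : Type u} [Group G] (M : CrossedMod G)

/-- The group `M` acts on `G` through the boundary map and conjugation, `g ^ m = g ^ (bdry m)`. -/
def actOn : M.carrierᵐᵒᵖ →* MulAut G := (conjRight G).comp M.bdry.op

theorem rpowAct_actOn (g : G) (m : M.carrier) :
    rpowAct M.actOn g m = (M.bdry m)⁻¹ * g * M.bdry m := by
  simp [rpowAct, actOn, conjRight]

theorem compatible : CompatibleActions M.actOn M.act := by
  refine ⟨fun g g₁ h => ?_, fun h h₁ g => ?_⟩
  · rw [rpowAct_actOn, rpowAct_mul, rpowAct_mul, M.peiffer]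
    congr 3
    rw [← map_inv, M.peiffer]
    simp
  · rw [rpowAct_actOn, rpowAct_actOn, M.bdry_act]
    group

/-- The underlying group of `M ⊗ G`. -/
abbrev Tensor : Type u := NonabelianTensor M.actOn M.act

/-- The generator `m ⊗ g` of `M ⊗ G`. -/
abbrev tmul (m : M.carrier) (g : G) : M.Tensor := NonabelianTensor.tmul M.actOn M.act m g

theorem act_conj (m : M.carrier) (g h : G) :
    rpowAct M.act (rpowAct M.act m g) (g⁻¹ * h * g) = rpowAct M.act (rpowAct M.act m h) g := by
  simp only [← rpowAct_mul]
  group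

/-- The endomorphism `m ⊗ g ↦ m ^ h ⊗ g ^ h` of `M ⊗ G`. -/
def tensorActHom (h : G) : M.Tensor →* M.Tensor :=
  NonabelianTensor.lift (fun m g => M.tmul (rpowAct M.act m h) (h⁻¹ * g * h))
    (fun m m₁ g => by
      rw [rpowAct_mul_left, tmul, NonabelianTensor.mul_tmul, rpowAct_actOn, rpowAct_actOn,
        M.bdry_act, rpowAct_mul_left, rpowAct_mul_left, rpowAct_inv_left]
      congr 2
      group)
    (fun m g g₁ => by
      have e : h⁻¹ * (g * g₁) * h = (h⁻¹ * g * h) * (h⁻¹ * g₁ * h) := by group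
      rw [e, tmul, NonabelianTensor.tmul_mul, act_conj]
      congr 2
      group)

theorem tensorActHom_tmul (h : G) (m : M.carrier) (g : G) :
    M.tensorActHom h (M.tmul m g) = M.tmul (rpowAct M.act m h) (h⁻¹ * g * h) :=
  NonabelianTensor.lift_tmul _ _ _ _ _

theorem tensorActHom_one : M.tensorActHom 1 = MonoidHom.id _ :=
  NonabelianTensor.hom_ext fun m g => by
    rw [tensorActHom_tmul, rpowAct_one]
    simp

theorem tensorActHom_comp (h k : G) :
    (M.tensorActHom k).comp (M.tensorActHom h) = M.tensorActHom (h * k) :=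
  NonabelianTensor.hom_ext fun m g => by
    rw [MonoidHom.comp_apply, tensorActHom_tmul, tensorActHom_tmul, tensorActHom_tmul,
      rpowAct_mul]
    congr 1
    group

/-- The diagonal action `(m ⊗ g) ^ h = m ^ h ⊗ g ^ h` of `G` on `M ⊗ G`. -/
def tensorAct : Gᵐᵒᵖ →* MulAut M.Tensor where
  toFun h := MonoidHom.toMulEquiv (M.tensorActHom h.unop) (M.tensorActHom h.unop⁻¹)
    (by rw [tensorActHom_comp, mul_inv_cancel, tensorActHom_one])
    (by rw [tensorActHom_comp, inv_mul_cancel, tensorActHom_one])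
  map_one' := by
    ext x
    exact DFunLike.congr_fun M.tensorActHom_one x
  map_mul' h k := by
    ext x
    exact (DFunLike.congr_fun (M.tensorActHom_comp k.unop h.unop) x).symm

theorem rpowAct_tensorAct (x : M.Tensor) (h : G) :
    rpowAct M.tensorAct x h = M.tensorActHom h x := rfl

/-- The homomorphism `M ⊗ G → G`, `m ⊗ g ↦ [bdry m, g]`, where `[a, b] = a⁻¹ * b⁻¹ * a * b`. -/
def tensorBdry : M.Tensor →* G :=
  NonabelianTensor.lift (fun m g => (M.bdry m)⁻¹ * g⁻¹ * M.bdry m * g)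
    (fun m m₁ g => by
      simp only [rpowAct_actOn, map_mul, map_inv]
      group)
    (fun m g g₁ => by
      rw [M.bdry_act]
      group)

theorem tensorBdry_tmul (m : M.carrier) (g : G) :
    M.tensorBdry (M.tmul m g) = (M.bdry m)⁻¹ * g⁻¹ * M.bdry m * g :=
  NonabelianTensor.lift_tmul _ _ _ _ _

theorem tensorBdry_act (x : M.Tensor) (h : G) :
    M.tensorBdry (M.tensorActHom h x) = h⁻¹ * M.tensorBdry x * h := by
  have e : M.tensorBdry.comp (M.tensorActHom h) =
      (MulAut.conj h⁻¹).toMonoidHom.comp M.tensorBdry :=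
    NonabelianTensor.hom_ext fun m g => by
      rw [MonoidHom.comp_apply, tensorActHom_tmul, tensorBdry_tmul, M.bdry_act,
        MonoidHom.comp_apply, tensorBdry_tmul]
      simp only [MulEquiv.coe_toMonoidHom, MulAut.conj_apply]
      group
  simpa using DFunLike.congr_fun e x

theorem tmul_comm (m m₁ : M.carrier) (g g₁ : G) :
    M.tensorActHom (g₁ * M.bdry m₁) (M.tmul m g) * M.tmul m₁ g₁ =
      M.tmul m₁ g₁ * M.tensorActHom (M.bdry m₁ * g₁) (M.tmul m g) := by
  have hA := NonabelianTensor.mul_tmul M.actOn M.act m m₁ (g * g₁)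
  have hB := NonabelianTensor.tmul_mul M.actOn M.act (m * m₁) g g₁
  rw [rpowAct_mul_left, NonabelianTensor.tmul_mul M.actOn M.act m₁ g g₁,
    NonabelianTensor.tmul_mul M.actOn M.act (m₁⁻¹ * m * m₁)] at hA
  rw [NonabelianTensor.mul_tmul M.actOn M.act m m₁ g₁, rpowAct_mul_left,
    NonabelianTensor.mul_tmul M.actOn M.act (rpowAct M.act m g₁)] at hB
  replace hB := hA.symm.trans hB
  simp only [mul_assoc] at hB
  have hC := mul_left_cancel hB
  simp only [← mul_assoc] at hC
  have hD := mul_right_cancel hC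
  rw [tensorActHom_tmul, tensorActHom_tmul]
  convert hD using 3
  · rw [← M.peiffer m m₁, rpowAct_actOn, act_conj, rpowAct_mul]
  · simp only [rpowAct_actOn]
    group
  · rw [← M.peiffer, M.bdry_act, act_conj, rpowAct_mul]
  · rw [rpowAct_actOn, M.bdry_act]
    group

theorem tensor_peiffer (x y : M.Tensor) :
    M.tensorActHom (M.tensorBdry y) x = y⁻¹ * x * y := by
  have key : ∀ (m m₁ : M.carrier) (g g₁ : G),
      M.tensorActHom (M.tensorBdry (M.tmul m₁ g₁)) (M.tmul m g) =
        (M.tmul m₁ g₁)⁻¹ * M.tmul m g * M.tmul m₁ g₁ := by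
    intro m m₁ g g₁
    have h := M.tmul_comm (rpowAct M.act m (g₁ * M.bdry m₁)⁻¹) m₁
      (g₁ * M.bdry m₁ * g * (g₁ * M.bdry m₁)⁻¹) g₁
    have e : M.tmul (rpowAct M.act m (g₁ * M.bdry m₁)⁻¹)
        (g₁ * M.bdry m₁ * g * (g₁ * M.bdry m₁)⁻¹) =
        M.tensorActHom (g₁ * M.bdry m₁)⁻¹ (M.tmul m g) := by
      rw [tensorActHom_tmul, inv_inv]
    rw [e, ← MonoidHom.comp_apply, ← MonoidHom.comp_apply, tensorActHom_comp,
      tensorActHom_comp, inv_mul_cancel, tensorActHom_one, MonoidHom.id_apply] at h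
    rw [mul_assoc, h, inv_mul_cancel_left, tensorBdry_tmul]
    congr 2
    group
  let S : Subgroup M.Tensor :=
    { carrier := {y | ∀ x, M.tensorActHom (M.tensorBdry y) x = y⁻¹ * x * y}
      one_mem' := fun x => by rw [map_one, tensorActHom_one]; simp
      mul_mem' := fun {a b} ha hb x => by
        rw [map_mul, ← tensorActHom_comp, MonoidHom.comp_apply, ha, hb]
        group
      inv_mem' := fun {a} ha x => by
        have h := ha (a * x * a⁻¹)
        have h2 : a⁻¹ * (a * x * a⁻¹) * a = x := by group
        rw [h2] at h
        rw [map_inv]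
        nth_rewrite 1 [← h]
        rw [← MonoidHom.comp_apply, tensorActHom_comp, mul_inv_cancel, tensorActHom_one,
          MonoidHom.id_apply, inv_inv] }
  refine PresentedGroup.generated_by _ S (fun j x => ?_) y x
  have e : M.tensorActHom (M.tensorBdry (M.tmul j.1 j.2)) =
      (MulAut.conj (M.tmul j.1 j.2)⁻¹).toMonoidHom :=
    NonabelianTensor.hom_ext fun m g => by simpa using key m j.1 g j.2
  have h := DFunLike.congr_fun e x
  simp only [MulEquiv.coe_toMonoidHom, MulAut.conj_apply, inv_inv] at h
  exact h

/-- The crossed module `M ⊗ G → G`, `m ⊗ g ↦ [bdry m, g]`, with the diagonal action of `G`. -/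
def tensor : CrossedMod G where
  carrier := M.Tensor
  act := M.tensorAct
  bdry := M.tensorBdry
  bdry_act x h := M.tensorBdry_act x h
  peiffer x y := M.tensor_peiffer x y

end CrossedMod

/-- `nFoldCrossedMod G k` is the `(k + 1)`-fold tensor product `G^{⊗(k+1)}` with the action of
`G` on it and the map `λ : G^{⊗(k+1)} → G` that sends `((g₁ ⊗ g₂) ⊗ ⋯) ⊗ gₖ₊₁` to the left-normed
commutator `[g₁, …, gₖ₊₁]`; the group `G^{⊗(k+1)}` acts on `G` by `g ^ x = g ^ (λ x)`. -/
def nFoldCrossedMod (G : Type u) [Group G] : ℕ → CrossedMod G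
  | 0 => CrossedMod.self G
  | k + 1 => (nFoldCrossedMod G k).tensor

/-- The `n`-fold non-abelian tensor product `G^{⊗n} = ((G ⊗ G) ⊗ ⋯) ⊗ G`, for `n ≥ 1`. -/
abbrev NFoldTensor (G : Type u) [Group G] (n : ℕ) : Type u :=
  (nFoldCrossedMod G (n - 1)).carrier

/-- `γₙ(G)`, for `n ≥ 1`: `γ₁(G) = G` and `γₙ₊₁(G) = [γₙ(G), G]`. Mathlib counts the terms of the
lower central series from `0`. -/
abbrev gammaSubgroup (G : Type u) [Group G] (n : ℕ) : Subgroup G :=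
  (⊤ : Subgroup G).lowerCentralSeries (n - 1)

/-! The map `λ : G^{⊗n} → G` is a crossed module with image `γₙ(G)`, and the Peiffer identity makes
its kernel central. Once that kernel is known to be finitely generated, both directions follow: a
quotient of a finitely presented group by a finitely generated normal subgroup is finitely
presented, and so is a central extension of a finitely presented group by a finitely generated one
(`Group.IsFinitelyPresented.of_central_extension`).

The kernel is handled by induction on `n`. The boundary of `M ⊗ G` factors through `μ : M ⊗ G → M`,
`m ⊗ g ↦ m⁻¹ m^g`. Thus `μ` carries the new kernel into the old one, which is finitely generated
abelian, and only `ker μ` remains. The identity `μ(x) ⊗ h = x⁻¹ x^h` shows that `G` fixes `ker μ`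
pointwise.

Such a fixed subgroup `J` is finitely generated (`CrossedMod.fg_of_trivial_action`). Pull the
crossed module back along a finite presentation `F → G` with `F` free, to `P = M ×_G F`. The central
kernel of `P → F` contains `J` and embeds in the abelianization of `P`, because subgroups of `F` are
free. This abelianization is a finitely generated `F`-module, and elements of `F` over the image of
`M` act trivially on it. That image contains a term of the lower central series, so a finitely
generated nilpotent group acts. Its integral group ring is noetherian (P. Hall), and a submodule
with trivial action is then finitely generated as a group. -/

open scoped commutatorElement

/-! ### Finite presentability of products, abelian groups and central extensions -/

theorem Group.IsFinitelyPresented.group_fg (G : Type*) [Group G]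
    [h : Group.IsFinitelyPresented G] : Group.FG G := by
  obtain ⟨n, φ, hφ, -⟩ := h.out
  exact Group.fg_of_surjective hφ

theorem Group.exists_finite_closure_eq_top (G : Type*) [Group G] [h : Group.FG G] :
    ∃ s : Set G, s.Finite ∧ Subgroup.closure s = ⊤ := by
  obtain ⟨s, hs, hf⟩ := Group.fg_iff.mp h
  exact ⟨s, hf, hs⟩

/-- The product is the free product modulo commutators of generators; finitely many suffice because
centralizers are subgroups. -/
theorem Group.IsFinitelyPresented.prod (G H : Type*) [Group G] [Group H]
    [hG : Group.IsFinitelyPresented G] [hH : Group.IsFinitelyPresented H] :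
    Group.IsFinitelyPresented (G × H) := by
  have := Group.IsFinitelyPresented.group_fg G
  have := Group.IsFinitelyPresented.group_fg H
  obtain ⟨s, hsf, hs⟩ := Group.exists_finite_closure_eq_top G
  obtain ⟨t, htf, ht⟩ := Group.exists_finite_closure_eq_top H
  let S : Set (Monoid.Coprod G H) :=
    Set.image2 (fun g h => ⁅(Monoid.Coprod.inl g : Monoid.Coprod G H), Monoid.Coprod.inr h⁆) s t
  let q := QuotientGroup.mk' (Subgroup.normalClosure S)
  have comm : ∀ g h, Commute ((q.comp Monoid.Coprod.inl) g) ((q.comp Monoid.Coprod.inr) h) := by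
    have h1 : ∀ g ∈ s, ∀ h ∈ t,
        Commute ((q.comp Monoid.Coprod.inl) g) ((q.comp Monoid.Coprod.inr) h) := by
      intro g hg h hh
      rw [← commutatorElement_eq_one_iff_commute, MonoidHom.comp_apply, MonoidHom.comp_apply,
        ← map_commutatorElement]
      exact (QuotientGroup.eq_one_iff _).mpr
        (Subgroup.subset_normalClosure (Set.mem_image2_of_mem hg hh))
    have h2 : ∀ g ∈ s, ∀ h, Commute ((q.comp Monoid.Coprod.inl) g)
        ((q.comp Monoid.Coprod.inr) h) := by
      intro g hg h
      have hle : Subgroup.closure t ≤ (Subgroup.centralizer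
          {(q.comp Monoid.Coprod.inl) g}).comap (q.comp Monoid.Coprod.inr) :=
        (Subgroup.closure_le _).mpr fun h hh =>
          Subgroup.mem_centralizer_singleton_iff.mpr (h1 g hg h hh).symm.eq
      exact Commute.symm (Subgroup.mem_centralizer_singleton_iff.mp
        (hle (ht ▸ Subgroup.mem_top h)))
    intro g h
    have hle : Subgroup.closure s ≤ (Subgroup.centralizer
        {(q.comp Monoid.Coprod.inr) h}).comap (q.comp Monoid.Coprod.inl) :=
      (Subgroup.closure_le _).mpr fun g hg =>
        Subgroup.mem_centralizer_singleton_iff.mpr (h2 g hg h).eq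
    exact Subgroup.mem_centralizer_singleton_iff.mp (hle (hs ▸ Subgroup.mem_top g))
  -- The quotient map factors through `G × H`, so it kills the whole kernel of the projection to `G
  -- × H`.
  have hback : ((q.comp Monoid.Coprod.inl).noncommCoprod (q.comp Monoid.Coprod.inr) comm).comp
      Monoid.Coprod.toProd = q := by
    ext x <;> simp
  refine Group.IsFinitelyPresented.of_surjective
    (Monoid.Coprod.toProd : Monoid.Coprod G H →* G × H) Monoid.Coprod.toProd_surjective
    ⟨S, hsf.image2 _ htf, le_antisymm (Subgroup.normalClosure_le_normal ?_) fun x hx => ?_⟩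
  · rintro _ ⟨g, -, h, -, rfl⟩
    rw [SetLike.mem_coe, MonoidHom.mem_ker, map_commutatorElement]
    ext <;> simp [commutatorElement_def]
  · rw [← QuotientGroup.eq_one_iff]
    change q x = 1
    rw [← hback, MonoidHom.comp_apply, MonoidHom.mem_ker.mp hx, map_one]

theorem Group.IsFinitelyPresented.multiplicative_int_pi (n : ℕ) :
    Group.IsFinitelyPresented (Multiplicative (Fin n → ℤ)) := by
  induction n with
  | zero => infer_instance
  | succ n ih =>
    have := Group.IsFinitelyPresented.prod (Multiplicative ℤ) (Multiplicative (Fin n → ℤ))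
    exact Group.IsFinitelyPresented.equiv
      ((MulEquiv.prodMultiplicative ℤ (Fin n → ℤ)).symm.trans
        (AddEquiv.toMultiplicative (Fin.consLinearEquiv ℤ fun _ : Fin (n + 1) => ℤ).toAddEquiv))

theorem Group.IsFinitelyPresented.of_fg_comm (K : Type*) [CommGroup K] [Group.FG K] :
    Group.IsFinitelyPresented K := by
  have : Module.Finite ℤ (Additive K) := Module.Finite.iff_addGroup_fg.mpr inferInstance
  obtain ⟨n, f, hf⟩ := Module.Finite.exists_fin' ℤ (Additive K)
  have := Group.IsFinitelyPresented.multiplicative_int_pi n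
  let g : Multiplicative (Fin n → ℤ) →* K := AddMonoidHom.toMultiplicativeLeft f.toAddMonoidHom
  refine Group.IsFinitelyPresented.of_surjective g hf ?_
  have hfg : (LinearMap.ker f).FG := IsNoetherian.noetherian _
  have : Group.FG g.ker := by
    rw [Submodule.fg_iff_addSubgroup_fg] at hfg
    rw [Group.fg_iff_subgroup_fg, Subgroup.fg_iff_add_fg]
    exact hfg
  exact Subgroup.IsFinitelyNormallyGenerated.of_FG _

/-- A central extension of a finitely presented group by a finitely generated group is finitely
presented. -/
theorem Group.IsFinitelyPresented.of_central_extension {T Γ : Type*} [Group T] [Group Γ]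
    (f : T →* Γ) (hf : Function.Surjective f) (hc : f.ker ≤ Subgroup.center T)
    [hK : Group.FG f.ker] [hΓ : Group.IsFinitelyPresented Γ] : Group.IsFinitelyPresented T := by
  obtain ⟨n, φ, hφ, S, hSf, hS⟩ := hΓ.out
  let cK : CommGroup f.ker :=
    { (inferInstance : Group f.ker) with
      mul_comm := fun a b => Subtype.ext (Subgroup.mem_center_iff.mp (hc b.2) a.1) }
  have : Group.IsFinitelyPresented f.ker := @Group.IsFinitelyPresented.of_fg_comm f.ker cK hK
  have := Group.IsFinitelyPresented.prod (FreeGroup (Fin n)) f.ker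
  let ψ : FreeGroup (Fin n) →* T := FreeGroup.lift fun i => (hf (φ (FreeGroup.of i))).choose
  have hψ : ∀ w, f (ψ w) = φ w := by
    intro w
    have : f.comp ψ = φ := by
      ext i
      simpa [ψ] using (hf (φ (FreeGroup.of i))).choose_spec
    exact DFunLike.congr_fun this w
  let Ψ : FreeGroup (Fin n) × f.ker →* T := ψ.noncommCoprod f.ker.subtype
    fun w k => Subgroup.mem_center_iff.mp (hc k.2) (ψ w)
  have hΨ : ∀ w k, Ψ (w, k) = ψ w * k := fun w k => rfl
  have hSker : ∀ s ∈ S, (ψ s)⁻¹ ∈ f.ker := fun s hs => by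
    have : φ s = 1 := MonoidHom.mem_ker.mp (hS ▸ Subgroup.subset_normalClosure hs)
    rw [MonoidHom.mem_ker, map_inv, hψ, this, inv_one]
  -- Each relator of `Γ` lifts to a central element of `T`; dividing by it turns the relator into a
  -- relation of `T`.
  let rel : S → FreeGroup (Fin n) × f.ker := fun s => (s, ⟨(ψ s)⁻¹, hSker s s.2⟩)
  have hle : Subgroup.normalClosure (Set.range rel) ≤ Ψ.ker := by
    refine Subgroup.normalClosure_le_normal ?_
    rintro _ ⟨s, rfl⟩
    simp [rel, hΨ]
  have := hSf.to_subtype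
  refine Group.IsFinitelyPresented.of_surjective Ψ (fun t => ?_)
    ⟨Set.range rel, Set.finite_range rel, le_antisymm hle ?_⟩
  · obtain ⟨w, hw⟩ := hφ (f t)
    refine ⟨(w, ⟨(ψ w)⁻¹ * t, ?_⟩), ?_⟩
    · rw [MonoidHom.mem_ker, map_mul, map_inv, hψ, hw, inv_mul_cancel]
    · rw [hΨ, mul_inv_cancel_left]
  · rintro ⟨w, k⟩ hwk
    have hwk' : ψ w * k = 1 := hwk
    have hw : w ∈ φ.ker := by
      have := congrArg f hwk'
      rwa [map_mul, hψ, MonoidHom.mem_ker.mp k.2, mul_one, map_one] at this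
    have hfst : φ.ker ≤ (Subgroup.normalClosure (Set.range rel)).map
        (MonoidHom.fst (FreeGroup (Fin n)) f.ker) := by
      have : ((Subgroup.normalClosure (Set.range rel)).map
          (MonoidHom.fst (FreeGroup (Fin n)) f.ker)).Normal :=
        Subgroup.Normal.map inferInstance _ Prod.fst_surjective
      rw [← hS]
      exact Subgroup.normalClosure_le_normal fun s hs =>
        ⟨rel ⟨s, hs⟩, Subgroup.subset_normalClosure ⟨_, rfl⟩, rfl⟩
    obtain ⟨⟨w', k'⟩, hm, rfl⟩ := hfst hw
    have hm' : ψ w' * k' = 1 := hle hm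
    -- Both `(w', k)` and `(w', k')` lie in the kernel of `Ψ`, so the first coordinate determines
    -- the second.
    have : k = k' := Subtype.ext (mul_left_cancel (hwk'.trans hm'.symm))
    rwa [this]

/-! ### Hilbert's basis theorem for skew Laurent extensions -/

section SkewLaurent

variable {R S : Type*} [Ring R] [Ring S] (f : R →+* S) (t : S)

/-- The additive subgroup of all sums `∑ i < n, t ^ i * f (a i)`. -/
def skewFiltration : ℕ → AddSubgroup S
  | 0 => ⊥
  | n + 1 => skewFiltration n ⊔ ((AddMonoidHom.mulLeft (t ^ n)).comp f.toAddMonoidHom).range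

theorem mem_skewFiltration_succ {n : ℕ} {x : S} :
    x ∈ skewFiltration f t (n + 1) ↔ ∃ y ∈ skewFiltration f t n, ∃ a, y + t ^ n * f a = x := by
  simp [skewFiltration, AddSubgroup.mem_sup]

theorem skewFiltration_mono : Monotone (skewFiltration f t) :=
  monotone_nat_of_le_succ fun _ => le_sup_left

theorem mul_mem_skewFiltration {n : ℕ} {x : S} (hx : x ∈ skewFiltration f t n) :
    t * x ∈ skewFiltration f t (n + 1) := by
  induction n generalizing x with
  | zero =>
    obtain rfl : x = 0 := hx
    rw [mul_zero]
    exact zero_mem _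
  | succ n ih =>
    obtain ⟨y, hy, a, rfl⟩ := (mem_skewFiltration_succ f t).mp hx
    exact (mem_skewFiltration_succ f t).mpr ⟨t * y, ih hy, a, by rw [mul_add, pow_succ', mul_assoc]⟩

theorem pow_mul_mem_skewFiltration {n : ℕ} {x : S} (hx : x ∈ skewFiltration f t n) (k : ℕ) :
    t ^ k * x ∈ skewFiltration f t (n + k) := by
  induction k with
  | zero => simpa using hx
  | succ k ih =>
    rw [pow_succ', mul_assoc]
    exact mul_mem_skewFiltration f t ih

variable {f t}

theorem exists_map_mul_pow (h : ∀ r, ∃ r', f r * t = t * f r') (n : ℕ) (r : R) :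
    ∃ r', f r * t ^ n = t ^ n * f r' := by
  induction n generalizing r with
  | zero => exact ⟨r, by simp⟩
  | succ n ih =>
    obtain ⟨a, ha⟩ := ih r
    obtain ⟨b, hb⟩ := h a
    exact ⟨b, by rw [pow_succ, ← mul_assoc, ha, mul_assoc, hb, mul_assoc]⟩

theorem exists_pow_mul_map (h : ∀ r, ∃ r', t * f r = f r' * t) (n : ℕ) (r : R) :
    ∃ r', t ^ n * f r = f r' * t ^ n := by
  induction n generalizing r with
  | zero => exact ⟨r, by simp⟩
  | succ n ih =>
    obtain ⟨a, ha⟩ := h r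
    obtain ⟨b, hb⟩ := ih a
    exact ⟨b, by rw [pow_succ, mul_assoc, ha, ← mul_assoc, hb, mul_assoc]⟩

theorem map_mul_mem_skewFiltration (h : ∀ r, ∃ r', f r * t = t * f r') {n : ℕ} (r : R) {x : S}
    (hx : x ∈ skewFiltration f t n) : f r * x ∈ skewFiltration f t n := by
  induction n generalizing x with
  | zero =>
    obtain rfl : x = 0 := hx
    rw [mul_zero]
    exact zero_mem _
  | succ n ih =>
    obtain ⟨y, hy, a, rfl⟩ := (mem_skewFiltration_succ f t).mp hx
    obtain ⟨r', hr'⟩ := exists_map_mul_pow h n r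
    exact (mem_skewFiltration_succ f t).mpr ⟨f r * y, ih hy, r' * a, by
      rw [mul_add, map_mul, ← mul_assoc, ← hr', mul_assoc]⟩

/-- The left ideal of leading coefficients of the elements of degree at most `n` of a left
ideal. -/
def leadingCoeffs (h₁ : ∀ r, ∃ r', t * f r = f r' * t) (h₂ : ∀ r, ∃ r', f r * t = t * f r')
    (I : Ideal S) (n : ℕ) : Ideal R where
  carrier := {a | ∃ y ∈ skewFiltration f t n, y + t ^ n * f a ∈ I}
  zero_mem' := ⟨0, zero_mem _, by simp⟩
  add_mem' := by
    rintro a b ⟨y, hy, hyI⟩ ⟨z, hz, hzI⟩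
    refine ⟨y + z, add_mem hy hz, ?_⟩
    have := add_mem hyI hzI
    rwa [add_add_add_comm, ← mul_add, ← map_add] at this
  smul_mem' := by
    rintro r a ⟨y, hy, hyI⟩
    obtain ⟨r', hr'⟩ := exists_pow_mul_map h₁ n r
    refine ⟨f r' * y, map_mul_mem_skewFiltration h₂ r' hy, ?_⟩
    have := I.mul_mem_left (f r') hyI
    rwa [mul_add, ← mul_assoc, ← hr', mul_assoc, ← map_mul] at this

/-- **Hilbert's basis theorem** for skew Laurent extensions. -/
theorem isNoetherianRing_of_skewLaurent [IsNoetherianRing R] (ht : IsUnit t)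
    (h₁ : ∀ r, ∃ r', t * f r = f r' * t) (h₂ : ∀ r, ∃ r', f r * t = t * f r')
    (hgen : ∀ s, ∃ m n, t ^ m * s ∈ skewFiltration f t n) : IsNoetherianRing S := by
  refine isNoetherianRing_iff_ideal_fg S |>.mpr fun I => ?_
  have hmono : Monotone (leadingCoeffs h₁ h₂ I) := by
    refine monotone_nat_of_le_succ fun n => ?_
    rintro a ⟨y, hy, hyI⟩
    refine ⟨t * y, mul_mem_skewFiltration f t hy, ?_⟩
    have := I.mul_mem_left t hyI
    rwa [mul_add, ← mul_assoc, ← pow_succ'] at this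
  obtain ⟨N, hN⟩ := monotone_stabilizes_iff_noetherian.mpr ‹IsNoetherianRing R›
    ⟨leadingCoeffs h₁ h₂ I, hmono⟩
  replace hN : ∀ m, N ≤ m → leadingCoeffs h₁ h₂ I N = leadingCoeffs h₁ h₂ I m := hN
  have hfg : ∀ n, ∃ s : Finset R, Ideal.span (s : Set R) = leadingCoeffs h₁ h₂ I n := fun n =>
    IsNoetherian.noetherian (leadingCoeffs h₁ h₂ I n)
  choose s hs using hfg
  have hlift : ∀ n (a : s n), ∃ y ∈ skewFiltration f t n, y + t ^ n * f a ∈ I := fun n a =>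
    (hs n ▸ Ideal.subset_span a.2 : (a : R) ∈ leadingCoeffs h₁ h₂ I n)
  choose y hy hyI using hlift
  -- Finitely many elements of `I` realize generators of the leading coefficient ideals up to degree
  -- `N`, where these ideals stabilize. Expansions in powers of `t` need not be unique anywhere in
  -- the argument.
  let B : Set S := ⋃ n ∈ Finset.range (N + 1), Set.range fun a : s n => y n a + t ^ n * f a
  have hBf : B.Finite := Set.Finite.biUnion (Finset.finite_toSet _) fun _ _ => Set.finite_range _
  have hBI : Ideal.span B ≤ I := by
    refine Ideal.span_le.mpr ?_
    simp only [B, Set.iUnion_subset_iff]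
    rintro n - _ ⟨a, rfl⟩
    exact hyI n a
  have hsmall : ∀ n ≤ N, leadingCoeffs h₁ h₂ I n ≤ leadingCoeffs h₁ h₂ (Ideal.span B) n := by
    intro n hn
    rw [← hs n, Ideal.span_le]
    intro a ha
    refine ⟨y n ⟨a, ha⟩, hy n _, Ideal.subset_span ?_⟩
    exact Set.mem_biUnion (Finset.mem_coe.mpr (Finset.mem_range.mpr (by omega))) ⟨⟨a, ha⟩, rfl⟩
  have hmonoB : ∀ n m, n ≤ m →
      leadingCoeffs h₁ h₂ (Ideal.span B) n ≤ leadingCoeffs h₁ h₂ (Ideal.span B) m := by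
    intro n m hnm
    induction m, hnm using Nat.le_induction with
    | base => exact le_rfl
    | succ m _ ih =>
      refine ih.trans ?_
      rintro a ⟨y, hy, hyI⟩
      refine ⟨t * y, mul_mem_skewFiltration f t hy, ?_⟩
      have := Ideal.mul_mem_left _ t hyI
      rwa [mul_add, ← mul_assoc, ← pow_succ'] at this
  have hall : ∀ n, leadingCoeffs h₁ h₂ I n ≤ leadingCoeffs h₁ h₂ (Ideal.span B) n := by
    intro n
    rcases le_total n N with hn | hn
    · exact hsmall n hn
    · rw [← hN n hn]
      exact (hsmall N le_rfl).trans (hmonoB N n hn)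
  have hmem : ∀ n x, x ∈ skewFiltration f t n → x ∈ I → x ∈ Ideal.span B := by
    intro n
    induction n with
    | zero =>
      intro x hx _
      obtain rfl : x = 0 := hx
      exact zero_mem _
    | succ n ih =>
      intro x hx hxI
      obtain ⟨z, hz, a, rfl⟩ := (mem_skewFiltration_succ f t).mp hx
      obtain ⟨w, hw, hwB⟩ := hall n ⟨z, hz, hxI⟩
      have := ih (z - w) (sub_mem hz hw) (by
        have := sub_mem hxI (hBI hwB)
        rwa [add_sub_add_right_eq_sub] at this)
      have := add_mem this hwB
      rwa [← add_assoc, sub_add_cancel] at this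
  refine ⟨hBf.toFinset, ?_⟩
  rw [Set.Finite.coe_toFinset]
  refine le_antisymm hBI fun x hx => ?_
  -- A power of the unit `t` clears the negative exponents of `x` and is cancelled at the end.
  obtain ⟨m, n, hmn⟩ := hgen x
  have := hmem n _ hmn (I.mul_mem_left _ hx)
  obtain ⟨u, hu⟩ := ht.pow m
  rw [← hu] at this
  simpa using Ideal.mul_mem_left _ (↑u⁻¹ : S) this

end SkewLaurent

/-! ### Integral group rings of finitely generated nilpotent groups, and modules over them -/

/-- The group ring of `Q` is a skew Laurent extension with `t = q`. Powers of `q` may meet the image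
of `φ`, so `q` may have finite order. -/
theorem MonoidAlgebra.isNoetherianRing_of_normalizes {H Q : Type*} [Group H] [Group Q]
    (φ : H →* Q) (q : Q) (h₁ : ∀ x, q * φ x * q⁻¹ ∈ φ.range) (h₂ : ∀ x, q⁻¹ * φ x * q ∈ φ.range)
    (hgen : ∀ g : Q, ∃ (i : ℤ) (x : H), g = q ^ i * φ x)
    [IsNoetherianRing (MonoidAlgebra ℤ H)] : IsNoetherianRing (MonoidAlgebra ℤ Q) := by
  let f := MonoidAlgebra.mapDomainRingHom ℤ φ
  let t : MonoidAlgebra ℤ Q := MonoidAlgebra.single q 1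
  have hf : ∀ x c, f (MonoidAlgebra.single x c) = MonoidAlgebra.single (φ x) c := fun x c => by
    simp [f]
  have htpow : ∀ n : ℕ, t ^ n = MonoidAlgebra.single (q ^ n) 1 := fun n => by
    simp [t, MonoidAlgebra.single_pow]
  have ht : IsUnit t := ⟨⟨t, MonoidAlgebra.single q⁻¹ 1, by
    simp [t, MonoidAlgebra.single_mul_single, MonoidAlgebra.one_def], by
    simp [t, MonoidAlgebra.single_mul_single, MonoidAlgebra.one_def]⟩, rfl⟩
  refine isNoetherianRing_of_skewLaurent (f := f) ht ?_ ?_ ?_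
  · intro r
    induction r using MonoidAlgebra.induction_linear with
    | zero => exact ⟨0, by simp⟩
    | add a b ha hb =>
      obtain ⟨a', ha'⟩ := ha
      obtain ⟨b', hb'⟩ := hb
      exact ⟨a' + b', by rw [map_add, mul_add, ha', hb', map_add, add_mul]⟩
    | single x c =>
      obtain ⟨x', hx'⟩ := h₁ x
      exact ⟨MonoidAlgebra.single x' c, by
        simp [hf, t, MonoidAlgebra.single_mul_single, hx']⟩
  · intro r
    induction r using MonoidAlgebra.induction_linear with
    | zero => exact ⟨0, by simp⟩
    | add a b ha hb =>
      obtain ⟨a', ha'⟩ := ha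
      obtain ⟨b', hb'⟩ := hb
      exact ⟨a' + b', by rw [map_add, add_mul, ha', hb', map_add, mul_add]⟩
    | single x c =>
      obtain ⟨x', hx'⟩ := h₂ x
      exact ⟨MonoidAlgebra.single x' c, by
        simp [hf, t, MonoidAlgebra.single_mul_single, hx', mul_assoc]⟩
  · intro s
    induction s using MonoidAlgebra.induction_linear with
    | zero => exact ⟨0, 0, by simp [zero_mem]⟩
    | add a b ha hb =>
      obtain ⟨m, n, h⟩ := ha
      obtain ⟨m', n', h'⟩ := hb
      refine ⟨m + m', (n + m') + (n' + m), ?_⟩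
      rw [mul_add]
      refine add_mem (skewFiltration_mono f t (Nat.le_add_right _ _) ?_)
        (skewFiltration_mono f t (Nat.le_add_left _ _) ?_)
      · rw [add_comm m, pow_add, mul_assoc]
        exact pow_mul_mem_skewFiltration f t h m'
      · rw [pow_add, mul_assoc]
        exact pow_mul_mem_skewFiltration f t h' m
    | single g c =>
      obtain ⟨i, x, rfl⟩ := hgen g
      refine ⟨(-i).toNat, i.toNat + 1, (mem_skewFiltration_succ f t).mpr
        ⟨0, zero_mem _, MonoidAlgebra.single x c, ?_⟩⟩
      have e : q ^ i.toNat = q ^ (-i).toNat * q ^ i := by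
        rw [← zpow_natCast, ← zpow_natCast, ← zpow_add]
        congr 1
        omega
      rw [zero_add, htpow, htpow, hf, MonoidAlgebra.single_mul_single,
        MonoidAlgebra.single_mul_single, e, mul_assoc]

theorem MonoidAlgebra.isNoetherianRing_sup_zpowers {Q : Type*} [Group Q] (N : Subgroup Q) (q : Q)
    (hq : ∀ x ∈ N, q * x * q⁻¹ ∈ N) (hq' : ∀ x ∈ N, q⁻¹ * x * q ∈ N)
    [IsNoetherianRing (MonoidAlgebra ℤ N)] :
    IsNoetherianRing (MonoidAlgebra ℤ (N ⊔ Subgroup.zpowers q : Subgroup Q)) := by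
  have hqm : q ∈ N ⊔ Subgroup.zpowers q :=
    Subgroup.mem_sup_right (Subgroup.mem_zpowers q)
  have hnorm : Subgroup.zpowers q ≤ Subgroup.normalizer (N : Set Q) := by
    rw [Subgroup.zpowers_le, Subgroup.mem_normalizer_iff]
    refine fun x => ⟨hq x, fun h => ?_⟩
    have := hq' _ h
    group at this
    simpa using this
  refine MonoidAlgebra.isNoetherianRing_of_normalizes
    (Subgroup.inclusion (le_sup_left : N ≤ N ⊔ Subgroup.zpowers q)) ⟨q, hqm⟩ ?_ ?_ ?_
  · exact fun x => ⟨⟨_, hq x x.2⟩, rfl⟩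
  · exact fun x => ⟨⟨_, hq' x x.2⟩, rfl⟩
  · rintro ⟨g, hg⟩
    rw [sup_comm, ← SetLike.mem_coe, Subgroup.coe_mul_of_left_le_normalizer_right _ _ hnorm] at hg
    obtain ⟨_, ⟨i, rfl⟩, x, hx, rfl⟩ := hg
    exact ⟨i, ⟨x, hx⟩, rfl⟩

/-- Every subgroup between `N` and `L` is normalized by `L`, since it contains `⁅L, L⁆`; so the
elements of `s` can be adjoined one at a time. -/
theorem MonoidAlgebra.isNoetherianRing_sup_closure {Q : Type*} [Group Q] {N L : Subgroup Q}
    (hNL : N ≤ L) (hcomm : ⁅L, L⁆ ≤ N) {s : Set Q} (hs : s.Finite) (hsL : s ⊆ L)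
    [hN : IsNoetherianRing (MonoidAlgebra ℤ N)] :
    IsNoetherianRing (MonoidAlgebra ℤ (N ⊔ Subgroup.closure s : Subgroup Q)) := by
  induction s, hs using Set.Finite.induction_on with
  | empty =>
    rwa [Subgroup.closure_empty, sup_bot_eq]
  | @insert a s _ _ ih =>
    rw [Set.insert_subset_iff] at hsL
    have := ih hsL.2
    have hle : N ⊔ Subgroup.closure s ≤ L := sup_le hNL ((Subgroup.closure_le L).mpr hsL.2)
    have hmem : ∀ b ∈ L, ∀ x ∈ N ⊔ Subgroup.closure s,
        b * x * b⁻¹ ∈ N ⊔ Subgroup.closure s := by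
      intro b hb x hx
      have h : ⁅b, x⁆ ∈ N ⊔ Subgroup.closure s :=
        Subgroup.mem_sup_left (hcomm (Subgroup.commutator_mem_commutator hb (hle hx)))
      have := mul_mem h hx
      rwa [commutatorElement_def, inv_mul_cancel_right] at this
    rw [Set.insert_eq, Set.union_comm, Subgroup.closure_union, ← sup_assoc,
      ← Subgroup.zpowers_eq_closure]
    refine MonoidAlgebra.isNoetherianRing_sup_zpowers _ a (hmem a hsL.1) fun x hx => ?_
    simpa using hmem a⁻¹ (inv_mem hsL.1) x hx

open Subgroup in
-- Modulo the next term, commutators depend bilinearly on their entries, so those of generators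
-- suffice. The proof phrases this as centrality in the quotient by the candidate subgroup `C`.
theorem Subgroup.exists_finite_lowerCentralSeries_le_sup (Q : Type*) [Group Q] [Group.FG Q]
    (n : ℕ) : ∃ s : Set Q, s.Finite ∧ s ⊆ (⊤ : Subgroup Q).lowerCentralSeries n ∧
      (⊤ : Subgroup Q).lowerCentralSeries n ≤
        (⊤ : Subgroup Q).lowerCentralSeries (n + 1) ⊔ closure s := by
  obtain ⟨S, hSf, hS⟩ := Group.exists_finite_closure_eq_top Q
  induction n with
  | zero => exact ⟨S, hSf, by simp, by rw [hS, sup_top_eq]; exact le_top⟩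
  | succ n ih =>
    obtain ⟨s, hsf, hsub, hle⟩ := ih
    have hsub' : Set.image2 (fun x y => ⁅x, y⁆) s S ⊆
        (⊤ : Subgroup Q).lowerCentralSeries (n + 1) := by
      rintro _ ⟨x, hx, y, -, rfl⟩
      exact commutator_mem_commutator (hsub hx) (mem_top y)
    refine ⟨Set.image2 (fun x y => ⁅x, y⁆) s S, hsf.image2 _ hSf, hsub', ?_⟩
    set C : Subgroup Q := (⊤ : Subgroup Q).lowerCentralSeries (n + 1 + 1) ⊔
      closure (Set.image2 (fun x y => ⁅x, y⁆) s S) with hC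
    have hCle : C ≤ (⊤ : Subgroup Q).lowerCentralSeries (n + 1) :=
      sup_le ((⊤ : Subgroup Q).lowerCentralSeries_antitone (Nat.le_succ _))
        ((closure_le _).mpr hsub')
    have hCn : C.Normal := by
      refine ⟨fun x hx g => ?_⟩
      have h : ⁅x, g⁆ ∈ C :=
        mem_sup_left (commutator_mem_commutator (hCle hx) (mem_top g))
      have := mul_mem (inv_mem h) hx
      simpa [commutatorElement_def, mul_assoc] using this
    let q := QuotientGroup.mk' C
    have hq : ∀ x y : Q, Commute (q x) (q y) ↔ ⁅x, y⁆ ∈ C := by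
      intro x y
      rw [← commutatorElement_eq_one_iff_commute, ← map_commutatorElement]
      exact QuotientGroup.eq_one_iff _
    have h1 : (⊤ : Subgroup Q).lowerCentralSeries n ≤ (center (Q ⧸ C)).comap q := by
      refine hle.trans (sup_le (fun x hx => ?_) ((closure_le _).mpr fun x hx => ?_))
      · refine mem_center_iff.mpr fun g => ?_
        obtain ⟨g, rfl⟩ := QuotientGroup.mk'_surjective C g
        exact ((hq x g).mpr
          (mem_sup_left (commutator_mem_commutator hx (mem_top g)))).symm.eq
      · have hcl : closure S ≤ (centralizer {q x}).comap q :=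
          (closure_le _).mpr fun y hy => mem_centralizer_singleton_iff.mpr
            ((hq x y).mpr (mem_sup_right (subset_closure (Set.mem_image2_of_mem hx hy)))).symm.eq
        refine mem_center_iff.mpr fun g => ?_
        obtain ⟨g, rfl⟩ := QuotientGroup.mk'_surjective C g
        exact mem_centralizer_singleton_iff.mp (hcl (hS ▸ mem_top g))
    exact commutator_le.mpr fun x hx y _ =>
      (hq x y).mp (Commute.symm (mem_center_iff.mp (h1 hx) (q y)))

/-- The integral group ring of a finitely generated nilpotent group is noetherian. -/
theorem MonoidAlgebra.isNoetherianRing_of_isNilpotent (Q : Type*) [Group Q] [Group.FG Q]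
    [hQ : Group.IsNilpotent Q] : IsNoetherianRing (MonoidAlgebra ℤ Q) := by
  obtain ⟨c, hc⟩ := Subgroup.nilpotent_iff_lowerCentralSeries.mp hQ
  -- The induction climbs the lower central series from its trivial bottom term, whose group ring is
  -- `ℤ`.
  have key : ∀ k ≤ c, IsNoetherianRing
      (MonoidAlgebra ℤ ((⊤ : Subgroup Q).lowerCentralSeries (c - k))) := by
    intro k
    induction k with
    | zero =>
      intro _
      rw [Nat.sub_zero, hc]
      exact isNoetherianRing_of_ringEquiv ℤ
        (MonoidAlgebra.uniqueRingEquiv (R := ℤ) (M := (⊥ : Subgroup Q))).symm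
    | succ k ih =>
      intro hk
      have := ih (by omega)
      have e : c - k = c - (k + 1) + 1 := by omega
      rw [e] at this
      generalize c - (k + 1) = i at this
      obtain ⟨s, hsf, hsub, hle⟩ := Subgroup.exists_finite_lowerCentralSeries_le_sup Q i
      have hanti := (⊤ : Subgroup Q).lowerCentralSeries_antitone (Nat.le_succ i)
      have heq := le_antisymm hle (sup_le hanti ((Subgroup.closure_le _).mpr hsub))
      rw [heq]
      exact MonoidAlgebra.isNoetherianRing_sup_closure hanti
        (Subgroup.commutator_mono le_rfl le_top) hsf hsub
  have := key c le_rfl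
  rw [Nat.sub_self, Subgroup.lowerCentralSeries_zero] at this
  exact isNoetherianRing_of_ringEquiv _
    (MonoidAlgebra.domCongr ℤ ℤ (Subgroup.topEquiv (G := Q))).toRingEquiv

/-- A subgroup with trivial action of a finitely generated module over a finitely generated group
is finitely generated if the group acts through a nilpotent quotient. -/
theorem AddSubgroup.fg_of_trivial_action {F A : Type*} [Group F] [Group.FG F] [AddCommGroup A]
    (ρ : F →* AddMonoid.End A) (n : ℕ)
    (hρ : ∀ x ∈ (⊤ : Subgroup F).lowerCentralSeries n, ρ x = 1) {s : Set A} (hs : s.Finite)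
    (hgen : ∀ B : AddSubgroup A, (∀ a ∈ s, ∀ x, ρ x a ∈ B) → B = ⊤)
    (J : AddSubgroup A) (hJ : ∀ a ∈ J, ∀ x, ρ x a = a) : J.FG := by
  let Q := F ⧸ (⊤ : Subgroup F).lowerCentralSeries n
  have hQ : Group.IsNilpotent Q := by
    refine Subgroup.nilpotent_iff_lowerCentralSeries.mpr ⟨n, ?_⟩
    have h := Subgroup.map_lowerCentralSeries (⊤ : Subgroup F)
      (QuotientGroup.mk' ((⊤ : Subgroup F).lowerCentralSeries n)) n
    rw [Subgroup.map_top_of_surjective _ (QuotientGroup.mk'_surjective _)] at h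
    rw [← h, QuotientGroup.map_mk'_self]
  have : IsNoetherianRing (MonoidAlgebra ℤ Q) :=
    MonoidAlgebra.isNoetherianRing_of_isNilpotent Q
  let ρQ : Q →* AddMonoid.End A := QuotientGroup.lift _ ρ hρ
  let ev : MonoidAlgebra ℤ Q →ₐ[ℤ] AddMonoid.End A := MonoidAlgebra.lift ℤ (AddMonoid.End A) Q ρQ
  let mod : Module (MonoidAlgebra ℤ Q) A := Module.compHom A ev.toRingHom
  have hsmul : ∀ (x : F) (c : ℤ) (a : A),
      (MonoidAlgebra.single (x : Q) c : MonoidAlgebra ℤ Q) • a = c • ρ x a := by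
    intro x c a
    change ev (MonoidAlgebra.single (x : Q) c) a = c • ρ x a
    rw [MonoidAlgebra.lift_single]
    rfl
  have hfin : Module.Finite (MonoidAlgebra ℤ Q) A := by
    refine ⟨hs.toFinset, ?_⟩
    rw [Set.Finite.coe_toFinset, ← Submodule.toAddSubgroup_inj]
    refine hgen _ fun a ha x => ?_
    have := (Submodule.span (MonoidAlgebra ℤ Q) s).smul_mem (MonoidAlgebra.single (x : Q) 1)
      (Submodule.subset_span ha)
    rwa [hsmul, one_smul] at this
  -- On `J` a group ring element acts as an integer, so every additive subgroup of `J` is a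
  -- submodule, and module generators of `J` are group generators.
  have hsmulJ : ∀ (r : MonoidAlgebra ℤ Q), ∀ B ≤ J, ∀ a ∈ B, r • a ∈ B := by
    intro r B hB a ha
    induction r using MonoidAlgebra.induction_linear with
    | zero => rw [zero_smul]; exact zero_mem _
    | add r r' hr hr' => rw [add_smul]; exact add_mem hr hr'
    | single x c =>
      obtain ⟨x, rfl⟩ := QuotientGroup.mk_surjective x
      rw [hsmul, hJ a (hB ha)]
      exact zsmul_mem ha c
  let JM : Submodule (MonoidAlgebra ℤ Q) A :=
    { J with smul_mem' := fun r a ha => hsmulJ r J le_rfl a ha }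
  obtain ⟨t, ht⟩ : JM.FG := IsNoetherian.noetherian JM
  have htJ : AddSubgroup.closure (t : Set A) ≤ J :=
    (AddSubgroup.closure_le _).mpr fun a ha => (ht ▸ Submodule.subset_span ha : a ∈ JM)
  let BM : Submodule (MonoidAlgebra ℤ Q) A :=
    { AddSubgroup.closure (t : Set A) with
      smul_mem' := fun r a ha => hsmulJ r _ htJ a ha }
  refine ⟨t, le_antisymm htJ fun a ha => ?_⟩
  have : JM ≤ BM := ht ▸ Submodule.span_le.mpr fun a ha => AddSubgroup.subset_closure ha
  exact this ha

/-! ### Generation of `M ⊗ G` and its map to `M` -/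

namespace CrossedMod

variable {G : Type u} [Group G] (M : CrossedMod G)

/-- The carrier of `M` is generated, as a group with an action of `G`, by a finite set. -/
def ActionFG : Prop :=
  ∃ s : Set M.carrier, s.Finite ∧
    ∀ C : Subgroup M.carrier, (∀ m ∈ s, ∀ g, rpowAct M.act m g ∈ C) → C = ⊤

theorem rpowAct_tensorAct_tmul (h : G) (m : M.carrier) (g : G) :
    rpowAct M.tensorAct (M.tmul m g) h = M.tmul (rpowAct M.act m h) (h⁻¹ * g * h) :=
  M.tensorActHom_tmul h m g

theorem tmul_mul (m : M.carrier) (g h : G) :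
    M.tmul m (g * h) = M.tmul m h * rpowAct M.tensorAct (M.tmul m g) h := by
  rw [rpowAct_tensorAct_tmul]
  exact NonabelianTensor.tmul_mul _ _ _ _ _

theorem mul_tmul (m m₁ : M.carrier) (g : G) :
    M.tmul (m * m₁) g = rpowAct M.tensorAct (M.tmul m g) (M.bdry m₁) * M.tmul m₁ g := by
  rw [rpowAct_tensorAct_tmul, M.peiffer, ← rpowAct_actOn]
  exact NonabelianTensor.mul_tmul _ _ _ _ _

theorem tmul_one (m : M.carrier) : M.tmul m 1 = 1 := by
  have h := M.tmul_mul m 1 1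
  rw [rpowAct_one, mul_one] at h
  exact (mul_eq_left.mp h.symm)

theorem one_tmul (g : G) : M.tmul 1 g = 1 := by
  have h := M.mul_tmul 1 1 g
  rw [map_one, rpowAct_one, mul_one] at h
  exact (mul_eq_left.mp h.symm)

theorem eq_top_of_tmul_mem {C : Subgroup M.Tensor} (h : ∀ m g, M.tmul m g ∈ C) : C = ⊤ :=
  (Subgroup.eq_top_iff' C).mpr fun x => PresentedGroup.generated_by _ C (fun j => h j.1 j.2) x

theorem tensor_actionFG [Group.FG G] (hM : M.ActionFG) : M.tensor.ActionFG := by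
  obtain ⟨s, hsf, hs⟩ := hM
  obtain ⟨S, hS, hSf⟩ := Group.fg_iff.mp (inferInstance : Group.FG G)
  refine ⟨Set.image2 (fun m g => M.tmul m g) s S, hsf.image2 _ hSf, fun C₀ hC₀ => ?_⟩
  -- The largest `G`-stable subgroup of `C₀`.
  let C : Subgroup M.Tensor := ⨅ g : G, C₀.comap (M.tensorActHom g)
  have hmem : ∀ {x : M.Tensor}, x ∈ C ↔ ∀ g, rpowAct M.tensorAct x g ∈ C₀ := by
    intro x
    exact Subgroup.mem_iInf
  have hact : ∀ {x : M.Tensor}, x ∈ C → ∀ g, rpowAct M.tensorAct x g ∈ C := by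
    intro x hx g
    rw [hmem]
    intro h
    rw [← rpowAct_mul]
    exact hmem.mp hx _
  have hle : C ≤ C₀ := fun x hx => by
    have := hmem.mp hx 1
    rwa [rpowAct_one] at this
  have hCS : ∀ m ∈ s, ∀ g ∈ S, M.tmul m g ∈ C := fun m hm g hg =>
    hmem.mpr fun h => hC₀ _ (Set.mem_image2_of_mem hm hg) h
  have h1 : ∀ m ∈ s, ∀ g, M.tmul m g ∈ C := by
    intro m hm g
    have hg : g ∈ Subgroup.closure S := hS ▸ Subgroup.mem_top g
    induction hg using Subgroup.closure_induction with
    | mem g hg => exact hCS m hm g hg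
    | one => rw [tmul_one]; exact one_mem _
    | mul a b _ _ ha hb =>
      rw [tmul_mul]
      exact mul_mem hb (hact ha b)
    | inv a _ ha =>
      have h := M.tmul_mul m a⁻¹ a
      rw [inv_mul_cancel, tmul_one, eq_comm, mul_eq_one_iff_inv_eq] at h
      have := hact (h ▸ inv_mem ha : rpowAct M.tensorAct (M.tmul m a⁻¹) a ∈ C) a⁻¹
      rwa [← rpowAct_mul, mul_inv_cancel, rpowAct_one] at this
  have h2 : ∀ m, ∀ g, M.tmul m g ∈ C := by
    let D : Subgroup M.carrier :=
      { carrier := {m | ∀ g, M.tmul m g ∈ C}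
        one_mem' := fun g => by rw [one_tmul]; exact one_mem _
        mul_mem' := fun {a b} ha hb g => by
          rw [mul_tmul]
          exact mul_mem (hact (ha g) _) (hb g)
        inv_mem' := fun {a} ha g => by
          have h := M.mul_tmul a⁻¹ a g
          rw [inv_mul_cancel, one_tmul, eq_comm, mul_eq_one_iff_eq_inv] at h
          have := hact (h ▸ inv_mem (ha g) :
            rpowAct M.tensorAct (M.tmul a⁻¹ g) (M.bdry a) ∈ C) (M.bdry a)⁻¹
          rwa [← rpowAct_mul, mul_inv_cancel, rpowAct_one] at this }
    have hD : D = ⊤ := hs D fun m hm g h => by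
      have := hact (h1 m hm (g * h * g⁻¹)) g
      rw [rpowAct_tensorAct_tmul] at this
      convert this using 2
      group
    exact fun m => (hD ▸ Subgroup.mem_top m : m ∈ D)
  exact eq_top_iff.mpr ((M.eq_top_of_tmul_mem h2).symm.le.trans hle)

/-- The homomorphism `M ⊗ G → M`, `m ⊗ g ↦ m⁻¹ * m ^ g`. -/
def tensorToCarrier : M.Tensor →* M.carrier :=
  NonabelianTensor.lift (fun m g => m⁻¹ * rpowAct M.act m g)
    (fun m m₁ g => by
      rw [rpowAct_actOn, ← M.peiffer, ← rpowAct_mul]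
      have e : M.bdry m₁ * ((M.bdry m₁)⁻¹ * g * M.bdry m₁) = g * M.bdry m₁ := by group
      rw [e, rpowAct_mul, M.peiffer, M.peiffer, rpowAct_mul_left]
      group)
    (fun m g g₁ => by
      rw [← rpowAct_mul]
      have e : g₁ * (g₁⁻¹ * g * g₁) = g * g₁ := by group
      rw [e]
      group)

theorem tensorToCarrier_tmul (m : M.carrier) (g : G) :
    M.tensorToCarrier (M.tmul m g) = m⁻¹ * rpowAct M.act m g :=
  NonabelianTensor.lift_tmul _ _ _ _ _

theorem bdry_comp_tensorToCarrier : M.bdry.comp M.tensorToCarrier = M.tensorBdry :=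
  NonabelianTensor.hom_ext fun m g => by
    rw [MonoidHom.comp_apply, tensorToCarrier_tmul, tensorBdry_tmul, map_mul, map_inv, M.bdry_act]
    group

theorem bdry_tensorToCarrier (x : M.Tensor) : M.bdry (M.tensorToCarrier x) = M.tensorBdry x :=
  DFunLike.congr_fun M.bdry_comp_tensorToCarrier x

theorem rpowAct_tensorBdry (x y : M.Tensor) :
    rpowAct M.tensorAct x (M.tensorBdry y) = y⁻¹ * x * y :=
  M.tensor_peiffer x y

/-- Two expansions of `m ⊗ gh` are compared, one from `gh` and one from `(g h g⁻¹) g`; the latter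
contains `m^g ⊗ h`, which is expanded again from `m^g = m (m⁻¹ m^g)`. -/
theorem tensorToCarrier_tmul_tmul (m : M.carrier) (g h : G) :
    M.tmul (m⁻¹ * rpowAct M.act m g) h =
      (M.tmul m g)⁻¹ * rpowAct M.tensorAct (M.tmul m g) h := by
  have e : m * (m⁻¹ * rpowAct M.act m g) = rpowAct M.act m g := mul_inv_cancel_left _ _
  have h1 := M.mul_tmul m (m⁻¹ * rpowAct M.act m g) h
  rw [e, ← tensorToCarrier_tmul, bdry_tensorToCarrier, rpowAct_tensorBdry] at h1
  have h2 := M.tmul_mul m (g * h * g⁻¹) g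
  have e2 : g⁻¹ * (g * h * g⁻¹) * g = h := by group
  rw [rpowAct_tensorAct_tmul, inv_mul_cancel_right, e2, tmul_mul, h1] at h2
  rw [← tensorToCarrier_tmul]
  simp only [mul_assoc, mul_inv_cancel_left] at h2
  exact eq_inv_mul_of_mul_eq (mul_left_cancel h2).symm

/-- Both sides obey the same product rule in `x`, because the boundary of `M ⊗ G` acts by
conjugation; so generators suffice. -/
theorem tensorToCarrier_tmul_eq (x : M.Tensor) (h : G) :
    M.tmul (M.tensorToCarrier x) h = x⁻¹ * rpowAct M.tensorAct x h := by
  let D : Subgroup M.Tensor :=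
    { carrier := {x | M.tmul (M.tensorToCarrier x) h = x⁻¹ * rpowAct M.tensorAct x h}
      one_mem' := by
        simp [rpowAct, one_tmul]
      mul_mem' := fun {a b} ha hb => by
        rw [Set.mem_ofPred_eq] at ha hb ⊢
        rw [map_mul, mul_tmul, ha, hb, bdry_tensorToCarrier, rpowAct_tensorBdry,
          rpowAct_mul_left]
        group
      inv_mem' := fun {a} ha => by
        rw [Set.mem_ofPred_eq] at ha ⊢
        have h1 := M.mul_tmul (M.tensorToCarrier a⁻¹) (M.tensorToCarrier a) h
        rw [← map_mul, inv_mul_cancel, map_one, one_tmul, ha, bdry_tensorToCarrier,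
          rpowAct_tensorBdry, eq_comm, mul_eq_one_iff_eq_inv] at h1
        rw [rpowAct_inv_left, inv_inv]
        have h2 : M.tmul (M.tensorToCarrier a⁻¹) h =
            a * (a⁻¹ * M.tmul (M.tensorToCarrier a⁻¹) h * a) * a⁻¹ := by group
        rw [h2, h1]
        group }
  have hD : D = ⊤ := M.eq_top_of_tmul_mem fun m g => by
    change M.tmul (M.tensorToCarrier (M.tmul m g)) h = _
    rw [tensorToCarrier_tmul, tensorToCarrier_tmul_tmul]
  exact (hD ▸ Subgroup.mem_top x : x ∈ D)

theorem rpowAct_of_mem_ker_tensorToCarrier {x : M.Tensor} (hx : x ∈ M.tensorToCarrier.ker)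
    (h : G) : rpowAct M.tensorAct x h = x := by
  have := M.tensorToCarrier_tmul_eq x h
  rw [MonoidHom.mem_ker.mp hx, one_tmul, eq_comm, inv_mul_eq_one] at this
  exact this.symm

theorem range_tensorBdry : M.tensorBdry.range = ⁅M.bdry.range, (⊤ : Subgroup G)⁆ := by
  refine le_antisymm ?_ (Subgroup.commutator_le.mpr ?_)
  · rintro _ ⟨x, rfl⟩
    have h : (⁅M.bdry.range, (⊤ : Subgroup G)⁆).comap M.tensorBdry = ⊤ :=
      M.eq_top_of_tmul_mem fun m g => by
        rw [Subgroup.mem_comap, tensorBdry_tmul, ← map_inv]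
        simpa [commutatorElement_def] using
          Subgroup.commutator_mem_commutator (MonoidHom.mem_range.mpr ⟨m⁻¹, rfl⟩)
            (Subgroup.mem_top g⁻¹)
    exact (h ▸ Subgroup.mem_top x : x ∈ Subgroup.comap M.tensorBdry _)
  · rintro _ ⟨m, rfl⟩ g -
    -- The inverses translate between `a⁻¹ b⁻¹ a b` and Mathlib's `a b a⁻¹ b⁻¹`.
    refine ⟨M.tmul m⁻¹ g⁻¹, ?_⟩
    rw [tensorBdry_tmul, map_inv, inv_inv, inv_inv]
    rfl

theorem ker_bdry_le_center : M.bdry.ker ≤ Subgroup.center M.carrier := by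
  refine fun k hk => Subgroup.mem_center_iff.mpr fun m => ?_
  have := M.peiffer m k
  rw [MonoidHom.mem_ker.mp hk, rpowAct_one, mul_assoc, eq_inv_mul_iff_mul_eq] at this
  exact this.symm

end CrossedMod

/-! ### Central kernels over free groups, and finite generation in extensions -/

theorem MonoidHom.exists_rightInverse_of_isFreeGroup {P F : Type*} [Group P] [Group F]
    [IsFreeGroup F] (f : P →* F) (hf : Function.Surjective f) :
    ∃ σ : F →* P, ∀ x, f (σ x) = x := by
  refine ⟨IsFreeGroup.lift fun i => (hf (IsFreeGroup.of i)).choose, fun x => ?_⟩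
  refine DFunLike.congr_fun (IsFreeGroup.ext_hom (f := f.comp _) (g := MonoidHom.id F) fun i => ?_) x
  simpa using (hf (IsFreeGroup.of i)).choose_spec

/-- The central kernel of a homomorphism to a free group embeds in the abelianization. -/
theorem Abelianization.of_injOn_ker_of_isFreeGroup {P : Type*} {F : Type u} [Group P] [Group F]
    [IsFreeGroup F] (f : P →* F) (hc : f.ker ≤ Subgroup.center P) :
    Set.InjOn (Abelianization.of : P →* Abelianization P) f.ker := by
  -- The image of `f` is free by Nielsen–Schreier, so a section `σ` exists. Then `p ↦ p σ(f p)⁻¹` is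
  -- a homomorphism to the center that is the identity on the kernel, and it factors through the
  -- abelianization.
  obtain ⟨σ, hσ⟩ := f.rangeRestrict.exists_rightInverse_of_isFreeGroup f.rangeRestrict_surjective
  have hmem : ∀ p, p * (σ (f.rangeRestrict p))⁻¹ ∈ Subgroup.center P := fun p => hc (by
    rw [← f.ker_rangeRestrict, MonoidHom.mem_ker, map_mul, map_inv, hσ, mul_inv_cancel])
  let r : P →* Subgroup.center P :=
    { toFun := fun p => ⟨p * (σ (f.rangeRestrict p))⁻¹, hmem p⟩
      map_one' := by simp
      map_mul' := fun p q => by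
        refine Subtype.ext ?_
        have h := Subgroup.mem_center_iff.mp (hmem q) (σ (f.rangeRestrict p))⁻¹
        simp only [map_mul, mul_inv_rev, Subgroup.coe_mul]
        rw [mul_assoc p (σ _)⁻¹, h]
        simp only [mul_assoc] }
  intro x hx y hy hxy
  have hr : ∀ z ∈ f.ker, (r z : P) = z := fun z hz => by
    have : f.rangeRestrict z = 1 := by rwa [← MonoidHom.mem_ker, f.ker_rangeRestrict]
    change z * (σ (f.rangeRestrict z))⁻¹ = z
    rw [this, map_one, inv_one, mul_one]
  let cc : CommGroup (Subgroup.center P) :=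
    { (inferInstance : Group (Subgroup.center P)) with
      mul_comm := fun a b => Subtype.ext (Subgroup.mem_center_iff.mp b.2 a.1) }
  have hrxy : r x = r y := by
    have := congrArg (Abelianization.lift (A := Subgroup.center P) r) hxy
    rwa [Abelianization.lift_apply_of, Abelianization.lift_apply_of] at this
  rw [← hr x hx, ← hr y hy, hrxy]

theorem Subgroup.FG.of_le_of_le_center {P : Type*} [Group P] {H K : Subgroup P} (hHK : H ≤ K)
    (hK : K.FG) (hc : K ≤ Subgroup.center P) : H.FG := by
  let cK : CommGroup K :=
    { (inferInstance : Group K) with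
      mul_comm := fun a b => Subtype.ext (Subgroup.mem_center_iff.mp (hc b.2) a.1) }
  have : Group.FG K := (Group.fg_iff_subgroup_fg K).mpr hK
  have : Module.Finite ℤ (Additive K) := Module.Finite.iff_addGroup_fg.mpr inferInstance
  have h : (AddSubgroup.toIntSubmodule (H.subgroupOf K).toAddSubgroup).FG :=
    IsNoetherian.noetherian _
  rw [Submodule.fg_iff_addSubgroup_fg] at h
  have h' : (H.subgroupOf K).FG := (Subgroup.fg_iff_add_fg _).mpr h
  rw [← Subgroup.map_subgroupOf_eq_of_le hHK]
  obtain ⟨S, hS, hSf⟩ := (Subgroup.fg_iff _).mp h'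
  rw [← hS, MonoidHom.map_closure]
  exact (Subgroup.fg_iff _).mpr ⟨_, rfl, hSf.image _⟩

theorem Subgroup.FG.of_map {P Q : Type*} [Group P] [Group Q] {f : P →* Q} {K : Subgroup P}
    (hmap : (K.map f).FG) (hle : f.ker ≤ K) (hker : f.ker.FG) : K.FG := by
  obtain ⟨S, hS, hSf⟩ := (Subgroup.fg_iff _).mp hmap
  have hSK : S ⊆ f '' K := fun x hx => (hS ▸ Subgroup.subset_closure hx : x ∈ K.map f)
  obtain ⟨T, hTf, rfl⟩ : ∃ T : Set P, T.Finite ∧ f '' T = S := by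
    refine ⟨Function.invFun f '' S, hSf.image _, ?_⟩
    rw [Set.image_image]
    refine (Set.image_congr fun x hx => Function.invFun_eq ?_).trans (Set.image_id S)
    obtain ⟨y, -, rfl⟩ := hSK hx
    exact ⟨y, rfl⟩
  have h := congrArg (Subgroup.comap f) hS
  rw [← MonoidHom.map_closure, Subgroup.comap_map_eq, Subgroup.comap_map_eq,
    sup_eq_left.mpr hle] at h
  rw [← h]
  exact ((Subgroup.fg_iff _).mpr ⟨T, rfl, hTf⟩).sup hker

/-! ### Pullback to a free group and finite generation of the kernel -/

namespace CrossedMod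

variable {G : Type u} [Group G] (M : CrossedMod G) {F : Type} [Group F] (φ : F →* G)

/-- The pullback `M ×_G F` of a crossed module along a homomorphism `F → G`. -/
def pullback : Subgroup (M.carrier × F) :=
  (M.bdry.comp (MonoidHom.fst _ _)).eqLocus (φ.comp (MonoidHom.snd _ _))

theorem mem_pullback {p : M.carrier × F} : p ∈ M.pullback φ ↔ M.bdry p.1 = φ p.2 := Iff.rfl

/-- The endomorphism `(m, f) ↦ (m ^ φ x⁻¹, x * f * x⁻¹)` of the pullback. -/
def pullbackActHom (x : F) : M.pullback φ →* M.pullback φ where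
  toFun p := ⟨(rpowAct M.act p.1.1 (φ x⁻¹), x * p.1.2 * x⁻¹), by
    rw [mem_pullback, M.bdry_act, (M.mem_pullback φ).mp p.2]
    simp⟩
  map_one' := by simp [rpowAct]
  map_mul' p q := by
    refine Subtype.ext (Prod.ext ?_ ?_)
    · simp [rpowAct_mul_left]
    · simp

theorem coe_pullbackActHom (x : F) (p : M.pullback φ) :
    (M.pullbackActHom φ x p : M.carrier × F) =
      (rpowAct M.act p.1.1 (φ x⁻¹), x * p.1.2 * x⁻¹) := rfl

theorem pullbackActHom_one : M.pullbackActHom φ 1 = MonoidHom.id _ := by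
  ext p
  · simp [coe_pullbackActHom, rpowAct_one]
  · simp [coe_pullbackActHom]

theorem pullbackActHom_mul (x y : F) :
    M.pullbackActHom φ (x * y) = (M.pullbackActHom φ x).comp (M.pullbackActHom φ y) := by
  ext p
  · simp [coe_pullbackActHom, rpowAct_mul]
  · simp [coe_pullbackActHom, mul_assoc]

/-- The Peiffer identity for `P → F`, in left-action form. It makes the kernel of `P → F` central
and the action on the abelianization trivial for elements of `F` that lift to `P`. -/
theorem pullbackActHom_snd (p q : M.pullback φ) :
    M.pullbackActHom φ p.1.2 q = p * q * p⁻¹ := by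
  refine Subtype.ext (Prod.ext ?_ ?_)
  · rw [coe_pullbackActHom, map_inv, ← (M.mem_pullback φ).mp p.2, ← map_inv, M.peiffer, inv_inv]
    rfl
  · rfl

/-- The action of `F` on the abelianization of the pullback. -/
def pullbackRep : F →* AddMonoid.End (Additive (Abelianization (M.pullback φ))) where
  toFun x := MonoidHom.toAdditive (Abelianization.map (M.pullbackActHom φ x))
  map_one' := by
    rw [pullbackActHom_one, Abelianization.map_id]
    rfl
  map_mul' x y := by
    rw [pullbackActHom_mul, ← Abelianization.map_comp]
    rfl

theorem pullbackRep_eq_one {x : F} (hx : φ x ∈ M.bdry.range) : M.pullbackRep φ x = 1 := by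
  obtain ⟨m, hm⟩ := hx
  ext a
  obtain ⟨p, hp⟩ := QuotientGroup.mk_surjective a.toMul
  obtain rfl : Additive.ofMul (Abelianization.of p) = a := congrArg Additive.ofMul hp
  have h := M.pullbackActHom_snd φ ⟨(m, x), hm⟩ p
  dsimp only at h
  have key : Abelianization.of (M.pullbackActHom φ x p) = Abelianization.of p := by
    rw [h, map_mul, map_mul, map_inv, mul_inv_cancel_comm]
  exact congrArg Additive.ofMul key

variable {φ}

/-- The projection `P → M` is onto with kernel `1 × ker φ`. Lifts of generators of `M` cover the
image, and the finitely many relators of `G` generate the kernel under the action of `F`. -/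
theorem exists_finite_pullback (hM : M.ActionFG) (hφ : Function.Surjective φ)
    (hker : φ.ker.IsFinitelyNormallyGenerated) : ∃ s : Set (M.pullback φ), s.Finite ∧
      ∀ C : Subgroup (M.pullback φ), (∀ p ∈ s, ∀ x, M.pullbackActHom φ x p ∈ C) → C = ⊤ := by
  obtain ⟨s, hsf, hs⟩ := hM
  obtain ⟨R, hRf, hR⟩ := hker
  have hRk : ∀ r ∈ R, φ r = 1 := fun r hr =>
    MonoidHom.mem_ker.mp (hR ▸ Subgroup.subset_normalClosure hr)
  choose l hl using fun m => hφ (M.bdry m)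
  let i : M.carrier → M.pullback φ := fun m => ⟨(m, l m), (hl m).symm⟩
  have := hRf.to_subtype
  let j : R → M.pullback φ := fun r => ⟨(1, r), by
    rw [mem_pullback, hRk r r.2, map_one]⟩
  refine ⟨i '' s ∪ Set.range j, (hsf.image _).union (Set.finite_range j), fun C hC => ?_⟩
  have hfst : (C.map (M.pullback φ).subtype).map (MonoidHom.fst _ _) = ⊤ := by
    refine hs _ fun m hm g => ?_
    obtain ⟨x, rfl⟩ := hφ g
    refine ⟨_, ⟨_, hC (i m) (Or.inl ⟨m, hm, rfl⟩) x⁻¹, rfl⟩, ?_⟩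
    simp [coe_pullbackActHom, i]
  have hk : φ.ker ≤ (C.map (M.pullback φ).subtype).comap (MonoidHom.inr _ _) := by
    rw [← hR, Subgroup.normalClosure, Subgroup.closure_le]
    intro y hy
    obtain ⟨r, hr, hry⟩ := Group.mem_conjugatesOfSet_iff.mp hy
    obtain ⟨x, rfl⟩ := isConj_iff.mp hry
    refine ⟨_, hC (j ⟨r, hr⟩) (Or.inr ⟨_, rfl⟩) x, ?_⟩
    simp [coe_pullbackActHom, j, rpowAct]
  refine (Subgroup.eq_top_iff' C).mpr fun p => ?_
  obtain ⟨_, ⟨q, hq, rfl⟩, hqp⟩ := (hfst ▸ Subgroup.mem_top p.1.1 :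
    p.1.1 ∈ (C.map (M.pullback φ).subtype).map (MonoidHom.fst _ _))
  have hqp' : q.1.1 = p.1.1 := hqp
  have : (q.1.2)⁻¹ * p.1.2 ∈ φ.ker := by
    rw [MonoidHom.mem_ker, map_mul, map_inv, ← (M.mem_pullback φ).mp q.2,
      ← (M.mem_pullback φ).mp p.2, hqp', inv_mul_cancel]
  obtain ⟨r, hr, hrp⟩ := hk this
  have e : p = q * r := by
    refine Subtype.ext ?_
    have hr' : (r : M.carrier × F) = (1, (q.1.2)⁻¹ * p.1.2) := hrp
    rw [Subgroup.coe_mul, hr']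
    refine Prod.ext ?_ ?_
    · simp [hqp']
    · simp
  rw [e]
  exact mul_mem hq hr

/-- This is where finite presentability of `G`, not just finite generation, enters the bound on the
kernel: it makes the abelianized pullback a finitely generated module. -/
theorem fg_of_trivial_action [hG : Group.IsFinitelyPresented G] (hM : M.ActionFG) {n : ℕ}
    (hn : (⊤ : Subgroup G).lowerCentralSeries n ≤ M.bdry.range) {J : Subgroup M.carrier}
    (hJ : J ≤ M.bdry.ker) (hJG : ∀ m ∈ J, ∀ g, rpowAct M.act m g = m) : J.FG := by
  obtain ⟨d, φ, hφ, hker⟩ := hG.out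
  obtain ⟨s, hsf, hs⟩ := M.exists_finite_pullback hM hφ hker
  let P := M.pullback φ
  let snd : P →* FreeGroup (Fin d) := (MonoidHom.snd _ _).comp P.subtype
  have hsnd : snd.ker ≤ Subgroup.center P := by
    refine fun k hk => Subgroup.mem_center_iff.mpr fun p => ?_
    have hk' : k.1.2 = 1 := hk
    have h := M.pullbackActHom_snd φ k p
    rw [hk', pullbackActHom_one, MonoidHom.id_apply, eq_mul_inv_iff_mul_eq] at h
    exact h
  have hinj := Abelianization.of_injOn_ker_of_isFreeGroup snd hsnd
  let ι : J →* P :=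
    { toFun := fun m => ⟨(m, 1), by
        rw [mem_pullback, MonoidHom.mem_ker.mp (hJ m.2), map_one]⟩
      map_one' := rfl
      map_mul' := fun a b => Subtype.ext (Prod.ext rfl (mul_one 1).symm) }
  let κ : J →* Abelianization P := Abelianization.of.comp ι
  have hκ : Function.Injective κ := fun a b hab => by
    have : ι a = ι b := hinj (show snd (ι a) = 1 from rfl) (show snd (ι b) = 1 from rfl) hab
    exact Subtype.ext (congrArg (fun p : P => p.1.1) this)
  have hfg : κ.range.toAddSubgroup.FG := by
    refine AddSubgroup.fg_of_trivial_action (M.pullbackRep φ) n (fun x hx => ?_)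
      (hsf.image fun p => Additive.ofMul (Abelianization.of p)) (fun B hB => ?_) _ ?_
    · refine M.pullbackRep_eq_one φ (hn ?_)
      have h := Subgroup.map_lowerCentralSeries (⊤ : Subgroup (FreeGroup (Fin d))) φ n
      rw [Subgroup.map_top_of_surjective _ hφ] at h
      exact h ▸ Subgroup.mem_map_of_mem φ hx
    · have h := hs ((AddSubgroup.toSubgroup' B).comap Abelianization.of) fun p hp x =>
        hB _ ⟨p, hp, rfl⟩ x
      refine (AddSubgroup.eq_top_iff' B).mpr fun a => ?_
      obtain ⟨p, hp⟩ := QuotientGroup.mk_surjective a.toMul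
      have hpB : p ∈ (AddSubgroup.toSubgroup' B).comap Abelianization.of := h ▸ Subgroup.mem_top p
      have : Abelianization.of p ∈ AddSubgroup.toSubgroup' B := hpB
      exact (congrArg (· ∈ AddSubgroup.toSubgroup' B) hp).mp this
    · rintro _ ⟨m, rfl⟩ x
      have : M.pullbackActHom φ x (ι m) = ι m := by
        refine Subtype.ext (Prod.ext ?_ ?_)
        · exact hJG m m.2 _
        · simp [coe_pullbackActHom, ι]
      exact congrArg (fun p => Additive.ofMul (Abelianization.of p)) this
  have : Group.FG κ.range :=
    (Group.fg_iff_subgroup_fg _).mpr ((Subgroup.fg_iff_add_fg _).mpr hfg)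
  rw [← Group.fg_iff_subgroup_fg]
  exact Group.fg_of_surjective (f := (MonoidHom.ofInjective hκ).symm.toMonoidHom)
    (MonoidHom.ofInjective hκ).symm.surjective

theorem tensor_ker_bdry_fg [hG : Group.IsFinitelyPresented G] (hM : M.ActionFG) {n : ℕ}
    (hn : (⊤ : Subgroup G).lowerCentralSeries n ≤ M.bdry.range) (hK : M.bdry.ker.FG) :
    M.tensor.bdry.ker.FG := by
  have := Group.IsFinitelyPresented.group_fg G
  let K : Subgroup M.Tensor := M.tensorBdry.ker
  have hμ : M.tensorToCarrier.ker ≤ K := fun x hx => by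
    rw [MonoidHom.mem_ker, ← bdry_tensorToCarrier, MonoidHom.mem_ker.mp hx, map_one]
  have hJ : M.tensorToCarrier.ker.FG := by
    -- The index rises by one, as the image of `M ⊗ G` is the commutator of the image of `M` with
    -- `G`.
    refine M.tensor.fg_of_trivial_action (M.tensor_actionFG hM) (n := n + 1) ?_ hμ
      fun x hx g => M.rpowAct_of_mem_ker_tensorToCarrier hx g
    exact (Subgroup.commutator_mono hn le_rfl).trans M.range_tensorBdry.ge
  have hmap : (K.map M.tensorToCarrier).FG := by
    have hle : K.map M.tensorToCarrier ≤ M.bdry.ker := by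
      rintro _ ⟨x, hx, rfl⟩
      rwa [MonoidHom.mem_ker, bdry_tensorToCarrier]
    exact Subgroup.FG.of_le_of_le_center hle hK M.ker_bdry_le_center
  exact Subgroup.FG.of_map hmap hμ hJ

theorem self_actionFG [Group.FG G] : (CrossedMod.self G).ActionFG := by
  obtain ⟨s, hs, hsf⟩ := Group.fg_iff.mp (inferInstance : Group.FG G)
  refine ⟨s, hsf, fun C hC => ?_⟩
  refine top_le_iff.mp (hs ▸ (Subgroup.closure_le C).mpr fun m hm => ?_)
  have := hC m hm 1
  rwa [rpowAct_one] at this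

end CrossedMod

/-! ### The induction on the number of tensor factors, and the theorem -/

/-- The three properties are proved jointly, because finite generation of the next kernel uses all
of them for the current crossed module. -/
theorem nFoldCrossedMod_properties {G : Type u} [Group G] [hG : Group.IsFinitelyPresented G]
    (k : ℕ) : (nFoldCrossedMod G k).ActionFG ∧
      (nFoldCrossedMod G k).bdry.range = (⊤ : Subgroup G).lowerCentralSeries k ∧
      (nFoldCrossedMod G k).bdry.ker.FG := by
  have := Group.IsFinitelyPresented.group_fg G
  induction k with
  | zero =>
    refine ⟨CrossedMod.self_actionFG, MonoidHom.range_eq_top.mpr Function.surjective_id, ?_⟩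
    have : (nFoldCrossedMod G 0).bdry.ker = ⊥ :=
      (MonoidHom.ker_eq_bot_iff _).mpr Function.injective_id
    rw [this]
    exact Subgroup.FG.bot
  | succ k ih =>
    obtain ⟨h1, h2, h3⟩ := ih
    refine ⟨CrossedMod.tensor_actionFG _ h1, ?_, CrossedMod.tensor_ker_bdry_fg _ h1 h2.ge h3⟩
    rw [Subgroup.lowerCentralSeries_succ, ← h2]
    exact CrossedMod.range_tensorBdry _

theorem mainTheorem1 {G : Type u} [Group G] (hG : Group.IsFinitelyPresented G)
    (n : ℕ) (hn : 2 ≤ n) :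
    Group.IsFinitelyPresented (NFoldTensor G n) ↔
      Group.IsFinitelyPresented (gammaSubgroup G n) := by
  obtain ⟨-, hrange, hker⟩ := nFoldCrossedMod_properties (G := G) (n - 1)
  set M := nFoldCrossedMod G (n - 1)
  rw [gammaSubgroup, ← hrange]
  have hFG : Group.FG M.bdry.rangeRestrict.ker := by
    rw [MonoidHom.ker_rangeRestrict]
    exact (Group.fg_iff_subgroup_fg _).mpr hker
  constructor
  · intro h
    exact Group.IsFinitelyPresented.of_surjective M.bdry.rangeRestrict
      M.bdry.rangeRestrict_surjective (Subgroup.IsFinitelyNormallyGenerated.of_FG _)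
  · intro h
    refine Group.IsFinitelyPresented.of_central_extension M.bdry.rangeRestrict
      M.bdry.rangeRestrict_surjective ?_
    rw [MonoidHom.ker_rangeRestrict]
    exact M.ker_bdry_le_center
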